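/- Let $\gamma\colon[0,1]\to\mathbb{R}^2$ be a simple rectifiable loop, that is, a continuous map of finite length with $\gamma(0)=\gamma(1)$ that is injective on $[0,1)$. Then there are parameters $0\le t_1<t_2<t_3<t_4<1$ such that $\gamma(t_1),\gamma(t_2),\gamma(t_3),\gamma(t_4)$ are, in this cyclic order, the vertices of a non-degenerate rectangle (one with sides of positive length), and such that the four pieces into which these points cut the loop, namely $\gamma^{(1)}=\gamma|_{[t_1,t_2]}$, $\gamma^{(2)}=\gamma|_{[t_2,t_3]}$, $\gamma^{(3)}=\gamma|_{[t_3,t_4]}$ and $\gamma^{(4)}$, which consists of $\gamma|_{[t_4,1]}$ followed by $\gamma|_{[0,t_1]}$, satisfy $$\operatorname{length}(\gamma^{(1)})+\operatorname{length}(\gamma^{(3)})=\operatorname{length}(\gamma^{(2)})+\operatorname{length}(\gamma^{(4)}).$$ -/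

import Mathlib

/-- `γ`, restricted to `[0, 1]`, is a simple loop: it is continuous on `[0, 1]`, closed, and
injective apart from the coincidence `γ 0 = γ 1`. Values outside `[0, 1]` play no role. -/
def IsSimpleLoop (γ : ℝ → EuclideanSpace ℝ (Fin 2)) : Prop :=
  ContinuousOn γ (Set.Icc 0 1) ∧ γ 0 = γ 1 ∧ Set.InjOn γ (Set.Ico 0 1)

/-- `γ`, restricted to `[0, 1]`, is rectifiable: the lengths of its inscribed polygonal paths
are bounded, that is, its total variation on `[0, 1]` is finite. -/
def IsRectifiable (γ : ℝ → EuclideanSpace ℝ (Fin 2)) : Prop :=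
  BoundedVariationOn γ (Set.Icc 0 1)

/-- The length of the piece of `γ` over `[a, b]`: the supremum of the lengths of its inscribed
polygonal paths. -/
noncomputable def pieceLength (γ : ℝ → EuclideanSpace ℝ (Fin 2)) (a b : ℝ) : ENNReal :=
  eVariationOn γ (Set.Icc a b)

/-- `A`, `B`, `C`, `D` are, in this cyclic order, the vertices of a non-degenerate rectangle: a
parallelogram with a right angle at `A` and sides of positive length. -/
def IsRectangle (A B C D : EuclideanSpace ℝ (Fin 2)) : Prop :=
  A ≠ B ∧ A ≠ D ∧ B - A = C - D ∧ inner ℝ (B - A) (D - A) = 0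

/-!
Let `Γ` be the loop parametrized proportionally to arc length, extended to the line with period
one. Cyclically ordered quadruples whose opposite gaps add up to one half form a family over a
cube: the sum `t₁ + t₃` and the gaps `t₂ - t₁`, `t₃ - t₂` are free. They span a rectangle exactly
if the two diagonals have the same midpoint and the same length, which is the vanishing of a map
`rectDefect Γ` from the cube to `ℝ³`.

This map has three symmetries. The cyclic shift of the four points changes the sign of the map and
carries the bottom of the cube to the top, turned by a right angle. On the lateral sides two
consecutive points coincide and the other two are half a period apart, so that the planar part (the
difference of midpoints) is a chord `±(Γ x - Γ (x + 1/2))` and does not vanish. Along the boundary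
of the bottom this chord is odd, hence winds around the origin an odd number of times.

A map with these properties has a zero (`exists_zero_of_antipodal`). The reason is a parity
argument in the style of Tucker and Ky Fan. If there were no zero, the points of a fine grid could
be labelled by a coordinate and a sign so that neighbours never have opposite labels
(`Label.ofVec`). The triangles labelled `{+0, -1, +2}` form a cocycle modulo 2
(`Label.altTri_cocycle`); none of them lies on the lateral sides, so the bottom and the top contain
equally many modulo 2. Since the top is the bottom with opposite signs, the bottom contains an even
number of triangles labelled `{+0, -1, +2}` or `{-0, +1, -2}`. This number has the same parity as
the number of edges `{+i, -j}`, `i < j`, on the boundary of the bottom, which is odd because that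
boundary is antipodal (`not_exists_antipodal_labelling`).

The zero is interior, since the map does not vanish on the lateral sides; hence the four parameters
are distinct and in cyclic order. The arc length of a simple rectifiable loop is continuous and
strictly increasing (`exists_arclength`), so that the condition on the gaps is the condition on the
lengths.
-/

/-! ### Labels and alternating simplices -/

section

open Finset

/-- A label records a coordinate of `ℝ³` and a sign, `0` standing for `+` and `1` for `-`. -/
abbrev Label := Fin 3 × ZMod 2

namespace Label

/-- The label with the same coordinate and the opposite sign. -/
def neg (a : Label) : Label := (a.1, a.2 + 1)

/-- Indicator, modulo 2, of the triangles labelled `{+0, -1, +2}`. -/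
def altTri (a b c : Label) : ZMod 2 :=
  if ({a, b, c} : Finset Label) = {(0, 0), (1, 1), (2, 0)} then 1 else 0

/-- Indicator, modulo 2, of the edges labelled `{+i, -j}` with `i < j`. -/
def altEdge (a b : Label) : ZMod 2 :=
  if (a.1 < b.1 ∧ a.2 = 0 ∧ b.2 = 1) ∨ (b.1 < a.1 ∧ b.2 = 0 ∧ a.2 = 1) then 1 else 0

/-- The number, modulo 2, of alternating triangles in the quadrilateral `abcd`, cut along `ac`. -/
def altQuad (a b c d : Label) : ZMod 2 := altTri a b c + altTri a c d

theorem altTri_swap (a b c : Label) : altTri a b c = altTri a c b := by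
  unfold altTri; rw [Finset.pair_comm]

theorem altTri_rotate (a b c : Label) : altTri a b c = altTri b c a := by
  unfold altTri
  congr 2
  ext x; simp only [mem_insert, mem_singleton]; tauto

theorem altEdge_comm : ∀ a b : Label, altEdge a b = altEdge b a := by decide

set_option maxRecDepth 100000 in
set_option maxHeartbeats 2000000 in
/-- A tetrahedron without an edge `{+i, -i}` has an even number of alternating faces: its four
labels cannot have pairwise different coordinates. -/
theorem altTri_cocycle {a b c d : Label} (hab : a ≠ neg b) (hac : a ≠ neg c) (had : a ≠ neg d)
    (hbc : b ≠ neg c) (hbd : b ≠ neg d) (hcd : c ≠ neg d) :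
    altTri b c d = altTri a c d + altTri a b d + altTri a b c := by
  have key : ∀ a b c d : Label, (a ≠ neg b ∧ a ≠ neg c ∧ a ≠ neg d ∧ b ≠ neg c ∧ b ≠ neg d ∧
      c ≠ neg d) → altTri b c d = altTri a c d + altTri a b d + altTri a b c := by
    decide
  exact key a b c d ⟨hab, hac, had, hbc, hbd, hcd⟩

set_option maxRecDepth 100000 in
set_option maxHeartbeats 1000000 in
/-- The alternating triangles of both signs, `{+0, -1, +2}` and `{-0, +1, -2}`, are the coboundary
modulo 2 of the edges `{+i, -j}` with `i < j`. -/
theorem altTri_add_neg : ∀ a b c : Label, a ≠ neg b → a ≠ neg c → b ≠ neg c →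
    altTri a b c + altTri (neg a) (neg b) (neg c) =
      altEdge a b + altEdge b c + altEdge a c := by
  decide

/-- Where the coordinate `2` does not occur, the edges `{+0, -1}` and `{-0, +1}` are the edges
along which the sign changes. -/
theorem altEdge_add_neg : ∀ a b : Label, a ≠ neg b → a.1 ≠ 2 → b.1 ≠ 2 →
    altEdge a b + altEdge (neg a) (neg b) = a.2 + b.2 := by
  decide

set_option maxRecDepth 100000 in
theorem altTri_eq_zero : ∀ a b c : Label, a.1 ≠ 2 → b.1 ≠ 2 → c.1 ≠ 2 → altTri a b c = 0 := by
  decide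

/-- The number of alternating triangles in a quadrilateral does not depend on the diagonal. -/
theorem altQuad_rotate {a b c d : Label} (hab : a ≠ neg b) (hac : a ≠ neg c) (had : a ≠ neg d)
    (hbc : b ≠ neg c) (hbd : b ≠ neg d) (hcd : c ≠ neg d) :
    altQuad a b c d = altQuad b c d a := by
  have h := altTri_cocycle hab hac had hbc hbd hcd
  have h2 := altTri_rotate a b d
  unfold altQuad
  grind

theorem altQuad_add_neg {a b c d : Label} (hab : a ≠ neg b) (hac : a ≠ neg c) (had : a ≠ neg d)
    (hbc : b ≠ neg c) (hcd : c ≠ neg d) :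
    altQuad a b c d + altQuad (neg a) (neg b) (neg c) (neg d) =
      altEdge a b + altEdge b c + altEdge c d + altEdge a d := by
  have h := altTri_add_neg a b c hab hac hbc
  have h2 := altTri_add_neg a c d hac had hcd
  have h3 := CharTwo.add_self_eq_zero (altEdge a c)
  unfold altQuad
  linear_combination h + h2 + h3

theorem altQuad_eq_zero {a b c d : Label} (ha : a.1 ≠ 2) (hb : b.1 ≠ 2) (hc : c.1 ≠ 2)
    (hd : d.1 ≠ 2) : altQuad a b c d = 0 := by
  simp [altQuad, altTri_eq_zero _ _ _ ha hb hc, altTri_eq_zero _ _ _ ha hc hd]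

/-- The surface of a cube whose labels are pairwise not opposite has an even number of alternating
triangles. -/
theorem altQuad_cube (v : Fin 8 → Label) (hv : ∀ p q, v p ≠ neg (v q)) :
    (altQuad (v 0) (v 2) (v 3) (v 1) + altQuad (v 4) (v 6) (v 7) (v 5)) +
    (altQuad (v 0) (v 4) (v 5) (v 1) + altQuad (v 2) (v 6) (v 7) (v 3)) +
    (altQuad (v 0) (v 4) (v 6) (v 2) + altQuad (v 1) (v 5) (v 7) (v 3)) = 0 := by
  -- Each triangle away from the vertex `v 0` is replaced by the cone from `v 0` over its edges;
  -- every edge is met twice.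
  have h (p q r : Fin 8) := altTri_cocycle (hv 0 p) (hv 0 q) (hv 0 r) (hv p q) (hv p r) (hv q r)
  have e (p q : Fin 8) := altTri_swap (v 0) (v p) (v q)
  unfold altQuad
  rw [h 4 6 7, h 4 7 5, h 2 6 7, h 2 7 3, h 1 5 7, h 1 7 3, e 7 5, e 3 1, e 5 1, e 6 2, e 7 3]
  ring_nf
  simp [show (2 : ZMod 2) = 0 from rfl]

end Label

/-! ### The parity argument on a grid -/

theorem sum_range_add_succ (f : ℕ → ZMod 2) (N : ℕ) :
    ∑ i ∈ range N, (f i + f (i + 1)) = f 0 + f N := by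
  induction N with
  | zero => simp [CharTwo.add_self_eq_zero]
  | succ N ih =>
    rw [sum_range_succ, ih]
    linear_combination CharTwo.add_self_eq_zero (f N)

open Label in
/-- A labelling of the grid `{0, …, N}³` in which neighbouring labels are never opposite, in which
the coordinate `2` does not occur on the four lateral sides, in which the top is the bottom turned
by a right angle with opposite signs, and in which the boundary of the bottom is antipodal, does
not exist. -/
theorem not_exists_antipodal_labelling (N : ℕ) (ℓ : ℕ → ℕ → ℕ → Label)
    (hadj : ∀ k i j k' i' j', k ≤ N → i ≤ N → j ≤ N → k' ≤ N → i' ≤ N → j' ≤ N →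
      k ≤ k' + 1 → k' ≤ k + 1 → i ≤ i' + 1 → i' ≤ i + 1 → j ≤ j' + 1 → j' ≤ j + 1 →
      ℓ k i j ≠ neg (ℓ k' i' j'))
    (hside₁ : ∀ k i j, k ≤ N → i ≤ N → (j = 0 ∨ j = N) → (ℓ k i j).1 ≠ 2)
    (hside₂ : ∀ k i j, k ≤ N → j ≤ N → (i = 0 ∨ i = N) → (ℓ k i j).1 ≠ 2)
    (htop : ∀ i j, i ≤ N → j ≤ N → ℓ N j (N - i) = neg (ℓ 0 i j))
    (hbot₁ : ∀ i, i ≤ N → ℓ 0 (N - i) N = neg (ℓ 0 i 0))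
    (hbot₂ : ∀ j, j ≤ N → ℓ 0 N (N - j) = neg (ℓ 0 0 j)) : False := by
  let X k i j := altQuad (ℓ k i j) (ℓ k (i + 1) j) (ℓ k (i + 1) (j + 1)) (ℓ k i (j + 1))
  let Y k i j := altQuad (ℓ k i j) (ℓ (k + 1) i j) (ℓ (k + 1) i (j + 1)) (ℓ k i (j + 1))
  let Z k i j := altQuad (ℓ k i j) (ℓ (k + 1) i j) (ℓ (k + 1) (i + 1) j) (ℓ k (i + 1) j)
  have hcube : ∀ k < N, ∀ i < N, ∀ j < N,
      (X k i j + X (k + 1) i j) + (Y k i j + Y k (i + 1) j) + (Z k i j + Z k i (j + 1)) = 0 := by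
    intro k hk i hi j hj
    refine altQuad_cube ![ℓ k i j, ℓ k i (j + 1), ℓ k (i + 1) j, ℓ k (i + 1) (j + 1),
      ℓ (k + 1) i j, ℓ (k + 1) i (j + 1), ℓ (k + 1) (i + 1) j, ℓ (k + 1) (i + 1) (j + 1)] ?_
    intro p q
    fin_cases p <;> fin_cases q <;> apply hadj <;> omega
  have hsum : ∑ k ∈ range N, ∑ i ∈ range N, ∑ j ∈ range N,
      ((X k i j + X (k + 1) i j) + (Y k i j + Y k (i + 1) j) + (Z k i j + Z k i (j + 1))) = 0 :=
    sum_eq_zero fun k hk ↦ sum_eq_zero fun i hi ↦ sum_eq_zero fun j hj ↦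
      hcube k (mem_range.1 hk) i (mem_range.1 hi) j (mem_range.1 hj)
  have hZ : ∑ k ∈ range N, ∑ i ∈ range N, ∑ j ∈ range N, (Z k i j + Z k i (j + 1)) = 0 := by
    refine sum_eq_zero fun k hk ↦ sum_eq_zero fun i hi ↦ ?_
    rw [mem_range] at hk hi
    rw [sum_range_add_succ]
    have h : ∀ j, (j = 0 ∨ j = N) → Z k i j = 0 := fun j hj ↦ by
      apply altQuad_eq_zero <;> apply hside₁ <;> first | exact hj | omega
    rw [h 0 (.inl rfl), h N (.inr rfl), add_zero]
  have hY : ∑ k ∈ range N, ∑ i ∈ range N, ∑ j ∈ range N, (Y k i j + Y k (i + 1) j) = 0 := by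
    refine sum_eq_zero fun k hk ↦ ?_
    rw [sum_comm]
    refine sum_eq_zero fun j hj ↦ ?_
    rw [mem_range] at hk hj
    rw [sum_range_add_succ (fun i ↦ Y k i j)]
    have h : ∀ i, (i = 0 ∨ i = N) → Y k i j = 0 := fun i hi ↦ by
      apply altQuad_eq_zero <;> apply hside₂ <;> first | exact hi | omega
    rw [h 0 (.inl rfl), h N (.inr rfl), add_zero]
  have hX : ∑ i ∈ range N, ∑ j ∈ range N, X 0 i j + ∑ i ∈ range N, ∑ j ∈ range N, X N i j = 0 := by
    simp only [sum_add_distrib] at hsum hY hZ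
    rw [hY, hZ, add_zero, add_zero, ← sum_add_distrib] at hsum
    rwa [sum_range_add_succ (fun k ↦ ∑ i ∈ range N, ∑ j ∈ range N, X k i j)] at hsum
  -- The top is the bottom turned by a right angle, with opposite signs.
  have hXN : ∑ i ∈ range N, ∑ j ∈ range N, X N i j = ∑ i ∈ range N, ∑ j ∈ range N,
      altQuad (neg (ℓ 0 i j)) (neg (ℓ 0 (i + 1) j)) (neg (ℓ 0 (i + 1) (j + 1)))
        (neg (ℓ 0 i (j + 1))) := by
    rw [sum_comm (s := range N) (t := range N) (f := fun i j ↦ altQuad (neg (ℓ 0 i j)) _ _ _)]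
    refine sum_congr rfl fun i hi ↦ ?_
    rw [← sum_range_reflect]
    refine sum_congr rfl fun j hj ↦ ?_
    rw [mem_range] at hi hj
    rw [← htop j i (by omega) (by omega), ← htop (j + 1) i (by omega) (by omega),
      ← htop (j + 1) (i + 1) (by omega) (by omega), ← htop j (i + 1) (by omega) (by omega)]
    have e1 : N - (j + 1) = N - 1 - j := by omega
    have e2 : N - j = N - 1 - j + 1 := by omega
    rw [e1, e2]
    symm
    apply altQuad_rotate <;> apply hadj <;> omega
  rw [hXN, ← sum_add_distrib] at hX
  let H i j := altEdge (ℓ 0 i j) (ℓ 0 (i + 1) j)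
  let V i j := altEdge (ℓ 0 i j) (ℓ 0 i (j + 1))
  have hHV : ∑ i ∈ range N, ∑ j ∈ range N, (H i j + H i (j + 1)) +
      ∑ i ∈ range N, ∑ j ∈ range N, (V i j + V (i + 1) j) = 0 := by
    rw [← hX, ← sum_add_distrib]
    refine sum_congr rfl fun i hi ↦ ?_
    rw [← sum_add_distrib, ← sum_add_distrib]
    refine sum_congr rfl fun j hj ↦ ?_
    rw [mem_range] at hi hj
    rw [altQuad_add_neg, altEdge_comm (ℓ 0 (i + 1) (j + 1))]
    · simp only [H, V]; ring
    all_goals apply hadj <;> omega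
  have hH : ∑ i ∈ range N, ∑ j ∈ range N, (H i j + H i (j + 1)) =
      (ℓ 0 0 0).2 + (ℓ 0 N 0).2 := by
    simp only [sum_range_add_succ (fun j ↦ H _ j)]
    rw [sum_add_distrib, ← sum_range_reflect (fun i ↦ H i N), ← sum_add_distrib,
      ← sum_range_add_succ (fun i ↦ (ℓ 0 i 0).2)]
    refine sum_congr rfl fun i hi ↦ ?_
    rw [mem_range] at hi
    have e1 : N - 1 - i = N - (i + 1) := by omega
    have e2 : N - (i + 1) + 1 = N - i := by omega
    simp only [H, e1, e2]
    rw [hbot₁ _ (by omega), hbot₁ _ (by omega), altEdge_comm (neg _)]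
    apply altEdge_add_neg
    · apply hadj <;> omega
    · apply hside₁ <;> omega
    · apply hside₁ <;> omega
  have hV : ∑ i ∈ range N, ∑ j ∈ range N, (V i j + V (i + 1) j) =
      (ℓ 0 0 0).2 + (ℓ 0 0 N).2 := by
    rw [sum_comm]
    simp only [sum_range_add_succ (fun i ↦ V i _)]
    rw [sum_add_distrib, ← sum_range_reflect (fun j ↦ V N j), ← sum_add_distrib,
      ← sum_range_add_succ (fun j ↦ (ℓ 0 0 j).2)]
    refine sum_congr rfl fun j hj ↦ ?_
    rw [mem_range] at hj
    have e1 : N - 1 - j = N - (j + 1) := by omega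
    have e2 : N - (j + 1) + 1 = N - j := by omega
    simp only [V, e1, e2]
    rw [hbot₂ _ (by omega), hbot₂ _ (by omega), altEdge_comm (neg _)]
    apply altEdge_add_neg
    · apply hadj <;> omega
    · apply hside₂ <;> omega
    · apply hside₂ <;> omega
  -- Antipodal corners have opposite signs, so that the boundary count is odd.
  have hcorner : (ℓ 0 N 0).2 = (ℓ 0 0 N).2 + 1 := by
    have := hbot₂ N le_rfl
    rw [Nat.sub_self] at this
    rw [this]; rfl
  rw [hH, hV, hcorner] at hHV
  have h1 : (1 : ZMod 2) = 0 := by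
    linear_combination hHV - CharTwo.add_self_eq_zero (ℓ 0 0 0).2 -
      CharTwo.add_self_eq_zero (ℓ 0 0 N).2
  exact one_ne_zero h1

end

/-! ### From labels to zeros of maps -/

namespace Label

/-- The sign of a real number as a bit: `0` if it is nonnegative, `1` otherwise. -/
noncomputable def signBit (x : ℝ) : ZMod 2 := if 0 ≤ x then 0 else 1

theorem signBit_neg {x : ℝ} (hx : x ≠ 0) : signBit (-x) = signBit x + 1 := by
  unfold signBit
  rcases lt_or_gt_of_ne hx with h | h
  · rw [if_pos (by linarith), if_neg (by linarith)]; rfl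
  · rw [if_neg (by linarith), if_pos (by linarith)]; rfl

/-- The first coordinate of `x` of absolute value at least `ε`, with its sign; the last coordinate
is taken when the others are smaller than `ε`. -/
noncomputable def ofVec (ε : ℝ) (x : Fin 3 → ℝ) : Label :=
  if ε ≤ |x 0| then (0, signBit (x 0)) else if ε ≤ |x 1| then (1, signBit (x 1))
    else (2, signBit (x 2))

theorem ofVec_snd (ε : ℝ) (x : Fin 3 → ℝ) : (ofVec ε x).2 = signBit (x (ofVec ε x).1) := by
  unfold ofVec; split_ifs <;> rfl

theorem le_abs_ofVec_fst {ε : ℝ} {x : Fin 3 → ℝ} (h : ∃ i, ε ≤ |x i|) :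
    ε ≤ |x (ofVec ε x).1| := by
  unfold ofVec
  split_ifs with h0 h1
  · exact h0
  · exact h1
  · obtain ⟨i, hi⟩ := h
    fin_cases i
    · exact absurd hi h0
    · exact absurd hi h1
    · exact hi

theorem ofVec_neg {ε : ℝ} (hε : 0 < ε) {x : Fin 3 → ℝ} (h : ∃ i, ε ≤ |x i|) :
    ofVec ε (-x) = neg (ofVec ε x) := by
  have h0 := le_abs_ofVec_fst h
  have hne : x (ofVec ε x).1 ≠ 0 := abs_pos.1 (hε.trans_le h0)
  have h1 : (ofVec ε (-x)).1 = (ofVec ε x).1 := by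
    simp only [ofVec, Pi.neg_apply, abs_neg]; split_ifs <;> rfl
  refine Prod.ext h1 ?_
  rw [ofVec_snd, h1, Pi.neg_apply, signBit_neg hne, neg, ofVec_snd]

theorem ofVec_eq_of_planar {ε : ℝ} {x y : Fin 3 → ℝ} (h : ε ≤ |x 0| ∨ ε ≤ |x 1|)
    (h0 : y 0 = x 0) (h1 : y 1 = x 1) : ofVec ε y = ofVec ε x := by
  simp only [ofVec, h0, h1]
  split_ifs <;> first | rfl | (exfalso; tauto)

theorem ofVec_fst_ne {ε : ℝ} {x : Fin 3 → ℝ} (h : ε ≤ |x 0| ∨ ε ≤ |x 1|) :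
    (ofVec ε x).1 ≠ 2 := by
  unfold ofVec
  split_ifs <;> first | simp; done | (exfalso; tauto)

theorem ofVec_ne_neg {ε : ℝ} {x y : Fin 3 → ℝ} (hx : ∃ i, ε ≤ |x i|)
    (hy : ∃ i, ε ≤ |y i|) (hxy : dist x y < ε) : ofVec ε x ≠ neg (ofVec ε y) := by
  intro h
  have h1 : (ofVec ε x).1 = (ofVec ε y).1 := by rw [h]; rfl
  have h2 : (ofVec ε x).2 = (ofVec ε y).2 + 1 := by rw [h]; rfl
  have hx' := le_abs_ofVec_fst hx
  have hy' := le_abs_ofVec_fst hy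
  rw [ofVec_snd, ofVec_snd, h1] at h2
  rw [h1] at hx'
  set i := (ofVec ε y).1
  have hd : |x i - y i| < ε := (dist_le_pi_dist x y i).trans_lt hxy
  unfold signBit at h2
  rw [abs_lt] at hd
  split_ifs at h2 with ha hb hb
  · simp at h2
  · rw [abs_of_nonneg ha] at hx'; linarith [not_le.1 hb]
  · rw [abs_of_nonneg hb] at hy'; linarith [not_le.1 ha]
  · simp at h2

end Label

/-- The topological core: a map from the unit cube to `ℝ³` has a zero if its first two coordinates
do not vanish together on the four lateral sides, its restriction to the top is minus its
restriction to the bottom turned by a right angle, and its first two coordinates are odd on the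
boundary of the bottom. -/
theorem exists_zero_of_antipodal (F : ℝ × ℝ × ℝ → Fin 3 → ℝ) (hF : Continuous F)
    (hside : ∀ s ∈ Set.Icc (0 : ℝ) 1, ∀ a ∈ Set.Icc (0 : ℝ) 1, ∀ b ∈ Set.Icc (0 : ℝ) 1,
      (a = 0 ∨ a = 1 ∨ b = 0 ∨ b = 1) → F (s, a, b) 0 ≠ 0 ∨ F (s, a, b) 1 ≠ 0)
    (htop : ∀ a b, F (1, b, 1 - a) = -F (0, a, b))
    (hbot₁ : ∀ a, ∀ i : Fin 3, i ≠ 2 → F (0, 1 - a, 1) i = -F (0, a, 0) i)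
    (hbot₂ : ∀ b, ∀ i : Fin 3, i ≠ 2 → F (0, 1, 1 - b) i = -F (0, 0, b) i) :
    ∃ s ∈ Set.Icc (0 : ℝ) 1, ∃ a ∈ Set.Icc (0 : ℝ) 1, ∃ b ∈ Set.Icc (0 : ℝ) 1,
      F (s, a, b) = 0 := by
  by_contra! hne
  let I := Set.Icc (0 : ℝ) 1
  let K : Set (ℝ × ℝ × ℝ) := I ×ˢ I ×ˢ I
  have hK : IsCompact K := isCompact_Icc.prod (isCompact_Icc.prod isCompact_Icc)
  let B : Set (ℝ × ℝ × ℝ) := K ∩ {p | p.2.1 = 0 ∨ p.2.1 = 1 ∨ p.2.2 = 0 ∨ p.2.2 = 1}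
  have hB : IsCompact B := by
    refine hK.inter_right ?_
    refine (isClosed_eq (by fun_prop) (by fun_prop)).union
      ((isClosed_eq (by fun_prop) (by fun_prop)).union
      ((isClosed_eq (by fun_prop) (by fun_prop)).union (isClosed_eq (by fun_prop) (by fun_prop))))
  have hF' (i : Fin 3) : Continuous fun p ↦ |F p i| := ((continuous_apply i).comp hF).abs
  obtain ⟨ε₁, hε₁, h₁⟩ : ∃ ε > 0, ∀ p ∈ K, ε ≤ ‖F p‖ :=
    hK.exists_forall_le' (hF.norm.continuousOn) (a := 0) fun p hp ↦
      norm_pos_iff.2 (hne p.1 hp.1 p.2.1 hp.2.1 p.2.2 hp.2.2)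
  obtain ⟨ε₂, hε₂, h₂⟩ : ∃ ε > 0, ∀ p ∈ B, ε ≤ max |F p 0| |F p 1| :=
    hB.exists_forall_le' (((hF' 0).max (hF' 1)).continuousOn) (a := 0) fun p hp ↦ by
      rw [lt_max_iff, abs_pos, abs_pos]
      exact hside p.1 hp.1.1 p.2.1 hp.1.2.1 p.2.2 hp.1.2.2 hp.2
  let ε := min ε₁ ε₂
  have hε : 0 < ε := lt_min hε₁ hε₂
  have hin : ∀ p ∈ K, ∃ i, ε ≤ |F p i| := by
    intro p hp
    by_contra! h
    exact absurd ((min_le_left ε₁ ε₂).trans (h₁ p hp)) (not_le.2 ((pi_norm_lt_iff hε).2 h))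
  have hbd : ∀ p ∈ B, ε ≤ |F p 0| ∨ ε ≤ |F p 1| := fun p hp ↦
    le_max_iff.1 ((min_le_right ε₁ ε₂).trans (h₂ p hp))
  obtain ⟨δ, hδ, hunif⟩ := Metric.uniformContinuousOn_iff.1
    (hK.uniformContinuousOn_of_continuous hF.continuousOn) ε hε
  obtain ⟨n, hn⟩ := exists_nat_one_div_lt hδ
  let N := n + 1
  have hN : (0 : ℝ) < N := by positivity
  have hNN : ((N : ℕ) : ℝ) / N = 1 := div_self hN.ne'
  let P (k i j : ℕ) : ℝ × ℝ × ℝ := ((k : ℝ) / N, (i : ℝ) / N, (j : ℝ) / N)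
  have hI : ∀ i ≤ N, (i : ℝ) / N ∈ I := fun i hi ↦
    ⟨by positivity, (div_le_one hN).2 (by exact_mod_cast hi)⟩
  have hPK : ∀ k i j, k ≤ N → i ≤ N → j ≤ N → P k i j ∈ K := fun k i j hk hi hj ↦
    ⟨hI k hk, hI i hi, hI j hj⟩
  have hPB₁ : ∀ k i j, k ≤ N → i ≤ N → (j = 0 ∨ j = N) → P k i j ∈ B := by
    refine fun k i j hk hi hj ↦ ⟨hPK k i j hk hi (by omega), .inr (.inr ?_)⟩
    rcases hj with rfl | rfl <;> simp [P]
  have hPB₂ : ∀ k i j, k ≤ N → j ≤ N → (i = 0 ∨ i = N) → P k i j ∈ B := by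
    refine fun k i j hk hj hi ↦ ⟨hPK k i j hk (by omega) hj, ?_⟩
    rcases hi with rfl | rfl <;> simp [P]
  have hdist : ∀ i i' : ℕ, i ≤ i' + 1 → i' ≤ i + 1 → dist ((i : ℝ) / N) ((i' : ℝ) / N) < δ := by
    intro i i' h h'
    refine lt_of_le_of_lt ?_ hn
    rw [Real.dist_eq, ← sub_div, abs_div, abs_of_pos hN]
    have h1 : (i : ℝ) ≤ i' + 1 := by exact_mod_cast h
    have h2 : (i' : ℝ) ≤ i + 1 := by exact_mod_cast h'
    have : |(i : ℝ) - i'| ≤ 1 := abs_le.2 ⟨by linarith, by linarith⟩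
    calc _ ≤ 1 / (N : ℝ) := by gcongr
      _ = 1 / ((n : ℝ) + 1) := by simp [N]
  have hsub : ∀ i ≤ N, ((N - i : ℕ) : ℝ) / N = 1 - (i : ℝ) / N := fun i hi ↦ by
    rw [Nat.cast_sub hi, sub_div, hNN]
  have hplanar : ∀ p ∈ B, ∀ q, (∀ i : Fin 3, i ≠ 2 → F q i = -F p i) →
      Label.ofVec ε (F q) = Label.neg (Label.ofVec ε (F p)) := by
    intro p hp q hq
    rw [← Label.ofVec_neg hε (hin p hp.1)]
    refine Label.ofVec_eq_of_planar ?_ (hq 0 (by decide)) (hq 1 (by decide))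
    simpa using hbd p hp
  refine not_exists_antipodal_labelling N (fun k i j ↦ Label.ofVec ε (F (P k i j)))
    ?_ ?_ ?_ ?_ ?_ ?_
  · intro k i j k' i' j' hk hi hj hk' hi' hj' h1 h2 h3 h4 h5 h6
    have hp := hPK k i j hk hi hj
    have hq := hPK k' i' j' hk' hi' hj'
    refine Label.ofVec_ne_neg (hin _ hp) (hin _ hq) (hunif _ hp _ hq ?_)
    exact max_lt (hdist _ _ h1 h2) (max_lt (hdist _ _ h3 h4) (hdist _ _ h5 h6))
  · exact fun k i j hk hi hj ↦ Label.ofVec_fst_ne (hbd _ (hPB₁ k i j hk hi hj))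
  · exact fun k i j hk hj hi ↦ Label.ofVec_fst_ne (hbd _ (hPB₂ k i j hk hj hi))
  · intro i j hi hj
    rw [← Label.ofVec_neg hε (hin _ (hPK 0 i j (by omega) hi hj))]
    simp only [P, hsub i hi, hNN, htop, Nat.cast_zero, zero_div]
  · intro i hi
    refine hplanar _ (hPB₁ 0 i 0 (by omega) hi (.inl rfl)) _ ?_
    simp only [P, hsub i hi, hNN, Nat.cast_zero, zero_div]
    exact hbot₁ _
  · intro j hj
    refine hplanar _ (hPB₂ 0 0 j (by omega) hj (.inl rfl)) _ ?_
    simp only [P, hsub j hj, hNN, Nat.cast_zero, zero_div]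
    exact hbot₂ _

/-! ### Inscribed rectangles of a periodic loop -/

/-- The four parameters attached to `(s, a, b)`: consecutive gaps are `a / 2`, `b / 2`,
`(1 - a) / 2`, `(1 - b) / 2`, so that opposite gaps add up to one half, and `s / 2` is the sum of
the first and the third parameter. -/
noncomputable def quadParam (p : ℝ × ℝ × ℝ) : Fin 4 → ℝ :=
  ![(p.1 - p.2.1 - p.2.2) / 4, (p.1 + p.2.1 - p.2.2) / 4, (p.1 + p.2.1 + p.2.2) / 4,
    (p.1 + 2 - p.2.1 + p.2.2) / 4]

/-- The obstruction for the quadrilateral inscribed in `Γ` at the parameters `quadParam p` to be a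
rectangle: twice the difference of the midpoints of the diagonals, and the difference of their
squared lengths. -/
noncomputable def rectDefect (Γ : ℝ → EuclideanSpace ℝ (Fin 2)) (p : ℝ × ℝ × ℝ) : Fin 3 → ℝ :=
  let t := quadParam p
  let m := Γ (t 0) + Γ (t 2) - Γ (t 1) - Γ (t 3)
  ![m 0, m 1, ‖Γ (t 0) - Γ (t 2)‖ ^ 2 - ‖Γ (t 1) - Γ (t 3)‖ ^ 2]

theorem continuous_quadParam : Continuous quadParam := by
  refine continuous_pi fun j ↦ ?_
  fin_cases j
  · exact (by fun_prop : Continuous fun p : ℝ × ℝ × ℝ ↦ (p.1 - p.2.1 - p.2.2) / 4)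
  · exact (by fun_prop : Continuous fun p : ℝ × ℝ × ℝ ↦ (p.1 + p.2.1 - p.2.2) / 4)
  · exact (by fun_prop : Continuous fun p : ℝ × ℝ × ℝ ↦ (p.1 + p.2.1 + p.2.2) / 4)
  · exact (by fun_prop : Continuous fun p : ℝ × ℝ × ℝ ↦ (p.1 + 2 - p.2.1 + p.2.2) / 4)

theorem continuous_rectDefect {Γ : ℝ → EuclideanSpace ℝ (Fin 2)} (hc : Continuous Γ) :
    Continuous (rectDefect Γ) := by
  have ht (j : Fin 4) : Continuous fun p ↦ Γ (quadParam p j) :=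
    hc.comp ((continuous_apply j).comp continuous_quadParam)
  have hm := (((ht 0).add (ht 2)).sub (ht 1)).sub (ht 3)
  refine continuous_pi fun i ↦ ?_
  fin_cases i
  · exact (EuclideanSpace.proj (𝕜 := ℝ) (0 : Fin 2)).continuous.comp hm
  · exact (EuclideanSpace.proj (𝕜 := ℝ) (1 : Fin 2)).continuous.comp hm
  · exact (((ht 0).sub (ht 2)).norm.pow 2).sub (((ht 1).sub (ht 3)).norm.pow 2)

theorem isRectangle_of_diagonals {A B C D : EuclideanSpace ℝ (Fin 2)} (hAB : A ≠ B) (hAD : A ≠ D)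
    (hmid : A + C - B - D = 0) (hlen : ‖A - C‖ ^ 2 = ‖B - D‖ ^ 2) : IsRectangle A B C D := by
  have h : B - A = C - D := by
    rw [← sub_eq_zero, ← neg_eq_zero, ← hmid]; abel
  refine ⟨hAB, hAD, h, ?_⟩
  have h1 : A - C = -((B - A) + (D - A)) := by
    rw [h]; abel
  have h2 : B - D = (B - A) - (D - A) := by abel
  rw [h1, norm_neg, norm_add_sq_real (B - A), h2, norm_sub_sq_real (B - A)] at hlen
  linarith

/-- A simple loop, parametrized by the real line with period one, has an inscribed rectangle with
opposite gaps adding up to one half. -/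
theorem exists_balanced_rectangle (Γ : ℝ → EuclideanSpace ℝ (Fin 2)) (hc : Continuous Γ)
    (hper : Function.Periodic Γ 1) (hinj : ∀ x y, Γ x = Γ y → ∃ n : ℤ, x - y = n) :
    ∃ t₁ t₂ t₃ t₄ : ℝ, t₁ < t₂ ∧ t₂ < t₃ ∧ t₃ < t₄ ∧ t₄ < t₁ + 1 ∧ 0 < t₃ ∧ t₄ < 1 ∧
      t₂ - t₁ + (t₄ - t₃) = 1 / 2 ∧ IsRectangle (Γ t₁) (Γ t₂) (Γ t₃) (Γ t₄) := by
  have hne : ∀ x y, x < y → y < x + 1 → Γ x ≠ Γ y := by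
    intro x y h1 h2 h
    obtain ⟨n, hn⟩ := hinj y x h.symm
    have h3 : (0 : ℝ) < n := by linarith
    have h4 : (n : ℝ) < 1 := by linarith
    have h5 : 0 < n := by exact_mod_cast h3
    have h6 : n < 1 := by exact_mod_cast h4
    omega
  have hvec : ∀ x y : EuclideanSpace ℝ (Fin 2), x ≠ y → (x - y) 0 ≠ 0 ∨ (x - y) 1 ≠ 0 := by
    intro x y h
    by_contra! hcon
    apply h
    rw [← sub_eq_zero]
    ext i
    fin_cases i
    · exact hcon.1
    · exact hcon.2
  -- On a lateral side two consecutive parameters agree, and the others differ by one half.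
  have hside : ∀ s ∈ Set.Icc (0 : ℝ) 1, ∀ a ∈ Set.Icc (0 : ℝ) 1, ∀ b ∈ Set.Icc (0 : ℝ) 1,
      (a = 0 ∨ a = 1 ∨ b = 0 ∨ b = 1) →
      rectDefect Γ (s, a, b) 0 ≠ 0 ∨ rectDefect Γ (s, a, b) 1 ≠ 0 := by
    intro s _ a _ b _ h
    have aux : ∀ x y : ℝ, x + 1 / 2 = y →
        ∀ m : EuclideanSpace ℝ (Fin 2), (m = Γ x - Γ y ∨ m = Γ y - Γ x) → m 0 ≠ 0 ∨ m 1 ≠ 0 := by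
      rintro x y hxy m (rfl | rfl)
      · exact hvec _ _ (hne _ _ (by linarith) (by linarith))
      · exact hvec _ _ (hne _ _ (by linarith) (by linarith)).symm
    rcases h with rfl | rfl | rfl | rfl
    · refine aux ((s + b) / 4) ((s + 2 + b) / 4) (by ring) _ (.inl ?_)
      simp [quadParam]
    · refine aux ((s - 1 - b) / 4) ((s + 1 - b) / 4) (by ring) _ (.inl ?_)
      have e : s + 2 - 1 + b = s + 1 + b := by ring
      simp [quadParam, e]; abel
    · refine aux ((s - a) / 4) ((s + 2 - a) / 4) (by ring) _ (.inl ?_)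
      simp [quadParam]
    · refine aux ((s + a - 1) / 4) ((s + a + 1) / 4) (by ring) _ (.inr ?_)
      have e : (s + 2 - a + 1) / 4 = (s - a - 1) / 4 + 1 := by ring
      simp [quadParam, e, hper _]; abel
  have htop : ∀ a b, rectDefect Γ (1, b, 1 - a) = -rectDefect Γ (0, a, b) := by
    intro a b
    have e0 : quadParam (1, b, 1 - a) 0 = quadParam (0, a, b) 1 := by simp [quadParam]
    have e1 : quadParam (1, b, 1 - a) 1 = quadParam (0, a, b) 2 := by simp [quadParam]; ring
    have e2 : quadParam (1, b, 1 - a) 2 = quadParam (0, a, b) 3 := by simp [quadParam]; ring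
    have e3 : quadParam (1, b, 1 - a) 3 = quadParam (0, a, b) 0 + 1 := by simp [quadParam]; ring
    unfold rectDefect
    simp only [e0, e1, e2, e3, hper _]
    rw [norm_sub_rev (Γ (quadParam (0, a, b) 2))]
    ext i
    fin_cases i <;> simp <;> ring
  have hbot₁ : ∀ a, ∀ i : Fin 3, i ≠ 2 →
      rectDefect Γ (0, 1 - a, 1) i = -rectDefect Γ (0, a, 0) i := by
    intro a i hi
    have e0 : quadParam (0, 1 - a, 1) 0 = (2 + a) / 4 - 1 := by simp [quadParam]; ring
    have e1 : quadParam (0, 1 - a, 1) 1 = -a / 4 := by simp [quadParam]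
    have e2 : quadParam (0, 1 - a, 1) 2 = (2 - a) / 4 := by simp [quadParam]; ring
    have e3 : quadParam (0, 1 - a, 1) 3 = (2 + a) / 4 := by simp [quadParam]; ring
    have f0 : quadParam (0, a, 0) 0 = -a / 4 := by simp [quadParam]
    have f1 : quadParam (0, a, 0) 1 = a / 4 := by simp [quadParam]
    have f2 : quadParam (0, a, 0) 2 = a / 4 := by simp [quadParam]
    have f3 : quadParam (0, a, 0) 3 = (2 - a) / 4 := by simp [quadParam]
    unfold rectDefect
    simp only [e0, e1, e2, e3, f0, f1, f2, f3, hper.sub_eq]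
    fin_cases i
    · simp; ring
    · simp; ring
    · exact absurd rfl hi
  have hbot₂ : ∀ b, ∀ i : Fin 3, i ≠ 2 →
      rectDefect Γ (0, 1, 1 - b) i = -rectDefect Γ (0, 0, b) i := by
    intro b i hi
    have e0 : quadParam (0, 1, 1 - b) 0 = (2 + b) / 4 - 1 := by simp [quadParam]; ring
    have e1 : quadParam (0, 1, 1 - b) 1 = b / 4 := by simp [quadParam]
    have e2 : quadParam (0, 1, 1 - b) 2 = (2 - b) / 4 := by simp [quadParam]; ring
    have e3 : quadParam (0, 1, 1 - b) 3 = (2 - b) / 4 := by simp [quadParam]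
    have f0 : quadParam (0, 0, b) 0 = -b / 4 := by simp [quadParam]
    have f1 : quadParam (0, 0, b) 1 = -b / 4 := by simp [quadParam]
    have f2 : quadParam (0, 0, b) 2 = b / 4 := by simp [quadParam]
    have f3 : quadParam (0, 0, b) 3 = (2 + b) / 4 := by simp [quadParam]
    unfold rectDefect
    simp only [e0, e1, e2, e3, f0, f1, f2, f3, hper.sub_eq]
    fin_cases i
    · simp; ring
    · simp; ring
    · exact absurd rfl hi
  obtain ⟨s, hs, a, ha, b, hb, h0⟩ :=
    exists_zero_of_antipodal (rectDefect Γ) (continuous_rectDefect hc) hside htop hbot₁ hbot₂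
  have hint : a ≠ 0 ∧ a ≠ 1 ∧ b ≠ 0 ∧ b ≠ 1 := by
    by_contra hcon
    have := hside s hs a ha b hb (by tauto)
    simp [h0] at this
  have ha0 : 0 < a := lt_of_le_of_ne ha.1 hint.1.symm
  have ha1 : a < 1 := lt_of_le_of_ne ha.2 hint.2.1
  have hb0 : 0 < b := lt_of_le_of_ne hb.1 hint.2.2.1.symm
  have hb1 : b < 1 := lt_of_le_of_ne hb.2 hint.2.2.2
  have hs0 := hs.1
  have hs1 := hs.2
  refine ⟨(s - a - b) / 4, (s + a - b) / 4, (s + a + b) / 4, (s + 2 - a + b) / 4, by linarith,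
    by linarith, by linarith, by linarith, by linarith, by linarith, by ring,
    isRectangle_of_diagonals (hne _ _ (by linarith) (by linarith))
      (hne _ _ (by linarith) (by linarith)) ?_ ?_⟩
  · ext i
    fin_cases i
    · exact congrFun h0 0
    · exact congrFun h0 1
  · exact sub_eq_zero.1 (congrFun h0 2)

theorem IsRectangle.rotate {A B C D : EuclideanSpace ℝ (Fin 2)} (h : IsRectangle A B C D) :
    IsRectangle B C D A := by
  obtain ⟨hAB, hAD, hpar, hperp⟩ := h
  have h1 : C - B = D - A := by
    rw [show C = B - A + D by rw [hpar]; abel]; abel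
  refine ⟨?_, hAB.symm, h1, ?_⟩
  · rintro rfl
    rw [sub_self, eq_comm, sub_eq_zero] at h1
    exact hAD h1.symm
  · rw [h1, ← neg_sub B A, inner_neg_right, real_inner_comm, hperp, neg_zero]

/-! ### Parametrization by arc length -/

/-- The normalized arc length of a simple rectifiable loop. -/
theorem exists_arclength {γ : ℝ → EuclideanSpace ℝ (Fin 2)} (hsimple : IsSimpleLoop γ)
    (hrect : IsRectifiable γ) :
    ∃ L : ℝ, 0 < L ∧ ∃ v : ℝ → ℝ, StrictMonoOn v (Set.Icc 0 1) ∧ ContinuousOn v (Set.Icc 0 1) ∧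
      v 0 = 0 ∧ v 1 = 1 ∧ ∀ x y, 0 ≤ x → x ≤ y → y ≤ 1 →
        pieceLength γ x y = ENNReal.ofReal (L * (v y - v x)) := by
  obtain ⟨hc, -, hinj⟩ := hsimple
  have hbv : BoundedVariationOn γ (Set.Icc 0 1) := hrect
  have hloc := hbv.locallyBoundedVariationOn
  let w : ℝ → ℝ := variationOnFromTo γ (Set.Icc 0 1) 0
  have h0 : (0 : ℝ) ∈ Set.Icc (0 : ℝ) 1 := by simp
  have h1 : (1 : ℝ) ∈ Set.Icc (0 : ℝ) 1 := by simp
  have hw0 : w 0 = 0 := variationOnFromTo.self _ _ _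
  have hsub : ∀ x ∈ Set.Icc (0 : ℝ) 1, ∀ y ∈ Set.Icc (0 : ℝ) 1,
      w y - w x = variationOnFromTo γ (Set.Icc 0 1) x y := fun x hx y hy ↦
    variationOnFromTo.sub_right hloc h0 hy hx
  have hmono : MonotoneOn w (Set.Icc 0 1) := variationOnFromTo.monotoneOn hloc h0
  -- A loop which is injective on `[0, 1)` is not constant on any interval.
  have hstrict : StrictMonoOn w (Set.Icc 0 1) := by
    intro x hx y hy hxy
    refine lt_of_le_of_ne (hmono hx hy hxy.le) fun h ↦ ?_
    let z := (x + y) / 2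
    have hxz : x < z := by simp only [z]; linarith
    have hzy : z < y := by simp only [z]; linarith
    have hz : z ∈ Set.Icc (0 : ℝ) 1 := ⟨hx.1.trans hxz.le, hzy.le.trans hy.2⟩
    have hwz : w x = w z :=
      le_antisymm (hmono hx hz hxz.le) ((hmono hz hy hzy.le).trans h.symm.le)
    have hd := variationOnFromTo.edist_zero_of_eq_zero hloc hx hz
      (by rw [← hsub x hx z hz, hwz, sub_self])
    exact hxz.ne (hinj ⟨hx.1, by linarith [hy.2]⟩ ⟨hz.1, by linarith [hy.2]⟩ (edist_eq_zero.1 hd))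
  have hcont : ContinuousOn w (Set.Icc 0 1) := by
    intro x hx
    have hl := hbv.tendsto_eVariationOn_Icc_zero_left (x := x)
      ((hc x hx).mono Set.inter_subset_left)
    have hr := hbv.tendsto_eVariationOn_Icc_zero_right x ((hc x hx).mono Set.inter_subset_left)
    have hl' := (ENNReal.tendsto_toReal ENNReal.zero_ne_top).comp hl
    have hr' := (ENNReal.tendsto_toReal ENNReal.zero_ne_top).comp hr
    have hlr := hl'.add hr'
    rw [ContinuousWithinAt, tendsto_iff_dist_tendsto_zero]
    refine squeeze_zero' (.of_forall fun _ ↦ dist_nonneg) ?_ (by simpa using hlr)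
    filter_upwards [self_mem_nhdsWithin] with y hy
    rw [Real.dist_eq, hsub x hx y hy]
    have n1 := ENNReal.toReal_nonneg (a := eVariationOn γ (Set.Icc 0 1 ∩ Set.Icc x y))
    have n2 := ENNReal.toReal_nonneg (a := eVariationOn γ (Set.Icc 0 1 ∩ Set.Icc y x))
    rcases le_total x y with h | h
    · rw [variationOnFromTo.eq_of_le _ _ h, abs_of_nonneg n1]
      simp
    · rw [variationOnFromTo.eq_of_ge _ _ h, abs_neg, abs_of_nonneg n2]
      simp
  have hL : 0 < w 1 := hw0 ▸ hstrict h0 h1 one_pos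
  refine ⟨w 1, hL, fun t ↦ w t / w 1, fun x hx y hy hxy ↦ ?_, hcont.div_const _, ?_, ?_, ?_⟩
  · exact div_lt_div_of_pos_right (hstrict hx hy hxy) hL
  · simp [hw0]
  · exact div_self hL.ne'
  · intro x y hx hxy hy
    have hx' : x ∈ Set.Icc (0 : ℝ) 1 := ⟨hx, hxy.trans hy⟩
    have hy' : y ∈ Set.Icc (0 : ℝ) 1 := ⟨hx.trans hxy, hy⟩
    have e : w 1 * (w y / w 1 - w x / w 1) = w y - w x := by field_simp
    have hI : Set.Icc (0 : ℝ) 1 ∩ Set.Icc x y = Set.Icc x y :=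
      Set.inter_eq_right.2 (Set.Icc_subset_Icc hx hy)
    have hfin := hloc x y hx' hy'
    rw [e, hsub x hx' y hy', variationOnFromTo.eq_of_le _ _ hxy, ENNReal.ofReal_toReal hfin, hI]
    rfl

/-- A strictly increasing continuous map of the unit interval onto itself has a continuous
inverse, extended to the line by constants. -/
theorem exists_continuous_inverse {v : ℝ → ℝ} (hmono : StrictMonoOn v (Set.Icc 0 1))
    (hcont : ContinuousOn v (Set.Icc 0 1)) (hv0 : v 0 = 0) (hv1 : v 1 = 1) :
    ∃ g : ℝ → ℝ, Continuous g ∧ (∀ x, g x ∈ Set.Icc (0 : ℝ) 1) ∧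
      ∀ x ∈ Set.Icc (0 : ℝ) 1, v (g x) = x := by
  have h0 : (0 : ℝ) ∈ Set.Icc (0 : ℝ) 1 := by simp
  have h1 : (1 : ℝ) ∈ Set.Icc (0 : ℝ) 1 := by simp
  have hmaps : Set.MapsTo v (Set.Icc 0 1) (Set.Icc 0 1) := fun x hx ↦
    ⟨hv0 ▸ hmono.monotoneOn h0 hx hx.1, hv1 ▸ hmono.monotoneOn hx h1 hx.2⟩
  have hsurj : Set.SurjOn v (Set.Icc 0 1) (Set.Icc 0 1) := by
    have := intermediate_value_Icc zero_le_one hcont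
    rwa [hv0, hv1] at this
  let e := (Set.BijOn.mk hmaps hmono.injOn hsurj).equiv
  have he : Continuous e := hcont.mapsToRestrict hmaps
  let E := he.homeoOfEquivCompactToT2
  refine ⟨fun x ↦ E.symm (Set.projIcc 0 1 zero_le_one x),
    continuous_subtype_val.comp (E.symm.continuous.comp continuous_projIcc),
    fun x ↦ (E.symm _).2, fun x hx ↦ ?_⟩
  have h := congrArg Subtype.val (E.apply_symm_apply (Set.projIcc 0 1 zero_le_one x))
  rw [Set.projIcc_of_mem zero_le_one hx] at h
  beta_reduce
  rw [Set.projIcc_of_mem zero_le_one hx]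
  exact h

/-! ### Balanced rectangles of a rectifiable loop -/

theorem theorem3p2 (γ : ℝ → EuclideanSpace ℝ (Fin 2))
    (hsimple : IsSimpleLoop γ) (hrect : IsRectifiable γ) :
    ∃ t₁ t₂ t₃ t₄ : ℝ, 0 ≤ t₁ ∧ t₁ < t₂ ∧ t₂ < t₃ ∧ t₃ < t₄ ∧ t₄ < 1 ∧
      IsRectangle (γ t₁) (γ t₂) (γ t₃) (γ t₄) ∧
      pieceLength γ t₁ t₂ + pieceLength γ t₃ t₄ =
        pieceLength γ t₂ t₃ + (pieceLength γ t₄ 1 + pieceLength γ 0 t₁) := by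
  obtain ⟨L, hL, v, hmono, hcont, hv0, hv1, hlen⟩ := exists_arclength hsimple hrect
  obtain ⟨g, hg, hgI, hvg⟩ := exists_continuous_inverse hmono hcont hv0 hv1
  obtain ⟨hc, hloop, hinj⟩ := hsimple
  have h0 : (0 : ℝ) ∈ Set.Icc (0 : ℝ) 1 := by simp
  have h1 : (1 : ℝ) ∈ Set.Icc (0 : ℝ) 1 := by simp
  have hg0 : g 0 = 0 := hmono.injOn (hgI 0) h0 ((hvg 0 h0).trans hv0.symm)
  have hg1 : g 1 = 1 := hmono.injOn (hgI 1) h1 ((hvg 1 h1).trans hv1.symm)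
  have hgmono : ∀ x ∈ Set.Icc (0 : ℝ) 1, ∀ y ∈ Set.Icc (0 : ℝ) 1, x < y → g x < g y := by
    intro x hx y hy hxy
    rw [← hmono.lt_iff_lt (hgI x) (hgI y), hvg x hx, hvg y hy]
    exact hxy
  -- The loop, parametrized proportionally to arc length and extended periodically.
  let Γ : ℝ → EuclideanSpace ℝ (Fin 2) := (γ ∘ g) ∘ Int.fract
  have hΓ : ∀ x, 0 ≤ x → x < 1 → Γ x = γ (g x) := fun x hx hx' ↦ by
    simp only [Γ, Function.comp_apply, Int.fract_eq_self.2 ⟨hx, hx'⟩]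
  have hΓc : Continuous Γ := by
    refine ContinuousOn.comp_fract'' ?_ ?_
    · exact hc.comp hg.continuousOn fun x _ ↦ hgI x
    · simp only [Function.comp_apply, hg0, hg1, hloop]
  have hΓper : Function.Periodic Γ 1 := fun x ↦ by simp [Γ]
  have hΓinj : ∀ x y, Γ x = Γ y → ∃ n : ℤ, x - y = n := by
    intro x y h
    have hf : ∀ z : ℝ, Int.fract z ∈ Set.Icc (0 : ℝ) 1 := fun z ↦
      ⟨Int.fract_nonneg z, (Int.fract_lt_one z).le⟩
    have hI : ∀ z : ℝ, g (Int.fract z) ∈ Set.Ico (0 : ℝ) 1 := fun z ↦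
      ⟨(hgI _).1, hg1 ▸ hgmono _ (hf z) 1 h1 (Int.fract_lt_one z)⟩
    have h2 := congrArg v (hinj (hI x) (hI y) h)
    rw [hvg _ (hf x), hvg _ (hf y)] at h2
    exact Int.fract_eq_fract.1 h2
  have key : ∀ p₁ p₂ p₃ p₄ : ℝ, 0 ≤ p₁ → p₁ < p₂ → p₂ < p₃ → p₃ < p₄ → p₄ < 1 →
      p₂ - p₁ + (p₄ - p₃) = 1 / 2 → IsRectangle (Γ p₁) (Γ p₂) (Γ p₃) (Γ p₄) →
      ∃ t₁ t₂ t₃ t₄ : ℝ, 0 ≤ t₁ ∧ t₁ < t₂ ∧ t₂ < t₃ ∧ t₃ < t₄ ∧ t₄ < 1 ∧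
      IsRectangle (γ t₁) (γ t₂) (γ t₃) (γ t₄) ∧
      pieceLength γ t₁ t₂ + pieceLength γ t₃ t₄ =
        pieceLength γ t₂ t₃ + (pieceLength γ t₄ 1 + pieceLength γ 0 t₁) := by
    intro p₁ p₂ p₃ p₄ hp₁ h12 h23 h34 hp₄ hbal hR
    rw [hΓ p₁ hp₁ (by linarith), hΓ p₂ (by linarith) (by linarith),
      hΓ p₃ (by linarith) (by linarith), hΓ p₄ (by linarith) hp₄] at hR
    have m₁ : p₁ ∈ Set.Icc (0 : ℝ) 1 := ⟨hp₁, by linarith⟩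
    have m₂ : p₂ ∈ Set.Icc (0 : ℝ) 1 := ⟨by linarith, by linarith⟩
    have m₃ : p₃ ∈ Set.Icc (0 : ℝ) 1 := ⟨by linarith, by linarith⟩
    have m₄ : p₄ ∈ Set.Icc (0 : ℝ) 1 := ⟨by linarith, hp₄.le⟩
    have g12 := hgmono _ m₁ _ m₂ h12
    have g23 := hgmono _ m₂ _ m₃ h23
    have g34 := hgmono _ m₃ _ m₄ h34
    refine ⟨g p₁, g p₂, g p₃, g p₄, (hgI _).1, g12, g23, g34, hg1 ▸ hgmono _ m₄ 1 h1 hp₄, hR, ?_⟩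
    rw [hlen _ _ (hgI _).1 g12.le (hgI _).2, hlen _ _ (hgI _).1 g34.le (hgI _).2,
      hlen _ _ (hgI _).1 g23.le (hgI _).2, hlen _ _ (hgI _).1 (hgI _).2 le_rfl,
      hlen _ _ le_rfl (hgI _).1 (hgI _).2, hv0, hv1, hvg _ m₁, hvg _ m₂, hvg _ m₃, hvg _ m₄]
    have q12 : 0 ≤ L * (p₂ - p₁) := mul_nonneg hL.le (by linarith)
    have q23 : 0 ≤ L * (p₃ - p₂) := mul_nonneg hL.le (by linarith)
    have q34 : 0 ≤ L * (p₄ - p₃) := mul_nonneg hL.le (by linarith)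
    have q4 : 0 ≤ L * (1 - p₄) := mul_nonneg hL.le (by linarith)
    have q1 : 0 ≤ L * (p₁ - 0) := mul_nonneg hL.le (by linarith)
    rw [← ENNReal.ofReal_add q12 q34, ← ENNReal.ofReal_add q4 q1,
      ← ENNReal.ofReal_add q23 (add_nonneg q4 q1)]
    congr 1
    linear_combination (2 * L) * hbal
  obtain ⟨t₁, t₂, t₃, t₄, h12, h23, h34, h41, h3, h4, hbal, hR⟩ :=
    exists_balanced_rectangle Γ hΓc hΓper hΓinj
  -- Negative parameters are moved to the end by a full period.
  rcases le_or_gt 0 t₁ with ht₁ | ht₁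
  · exact key t₁ t₂ t₃ t₄ ht₁ h12 h23 h34 h4 hbal hR
  have hR' := hR.rotate
  rw [← hΓper t₁] at hR'
  rcases le_or_gt 0 t₂ with ht₂ | ht₂
  · exact key t₂ t₃ t₄ (t₁ + 1) ht₂ h23 h34 h41 (by linarith) (by linarith) hR'
  · have hR'' := hR'.rotate
    rw [← hΓper t₂] at hR''
    exact key t₃ t₄ (t₁ + 1) (t₂ + 1) h3.le h34 h41 (by linarith) (by linarith) (by linarith) hR''
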